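/- Let $N$ be a finite set of $n$ items and $M$ a finite set of agents. Every agent $\ell\in M$ has a valuation function $v_\ell:2^N\to\mathbb{R}_{\ge 0}$ that is monotone and submodular. For a set function $f$ put $MG(A,e)=f(A\cup\{e\})-f(A)$ and $GR(A,S,e)=MG(A,e)-MG(A\cup S,e)$; a submodular function $f$ is called \emph{second-order supermodular} if $GR(A,S,e)\ge GR(B,S,e)$ for all sets $A\subseteq B\subseteq N$, all sets $S\subseteq N$ with $S\cap B=\emptyset$ and all $e\in N$. The items arrive one by one, and the Greedy algorithm irrevocably assigns each arriving item $e$ to an agent $\ell$ that maximizes the marginal gain $v_\ell(A_\ell\cup\{e\})-v_\ell(A_\ell)$, where $A_\ell$ is the set of items that agent $\ell$ holds at that time (ties are broken arbitrarily, depending only on the items that have arrived so far and on their order). Let $\mathsf{OPT}$ be the maximum of the social welfare $\sum_{\ell\in M}v_\ell(S_\ell)$ over all allocations of items to agents in which each item goes to at most one agent (so the $S_\ell$ are pairwise disjoint). Theorem 2. If the valuation function of every agent is second-order supermodular, then in the random order model the competitive ratio of Greedy is at least $0.5104$: the social welfare of the allocation that Greedy produces, in expectation over a uniformly random one of the $n!$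 arrival orders of the items, is at least $0.5104\cdot\mathsf{OPT}$. -/

import Mathlib

open Finset
open scoped Nat

section OnlineSWM

/-- Submodularity of a real-valued set function on the finite subsets of `N`. -/
def IsSubmodular {N : Type*} [DecidableEq N] (f : Finset N → ℝ) : Prop :=
  ∀ A B : Finset N, f (A ∪ B) + f (A ∩ B) ≤ f A + f B

/-- A valuation function: non-negative, monotone and submodular. -/
structure IsValuation {N : Type*} [DecidableEq N] (f : Finset N → ℝ) : Prop where
  nonneg : ∀ A : Finset N, 0 ≤ f A
  monotone : Monotone f
  submodular : IsSubmodular f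

/-- The marginal gain `MG(A, e) = f(A ∪ {e}) - f(A)`. -/
def marginalGain {N : Type*} [DecidableEq N] (f : Finset N → ℝ) (A : Finset N) (e : N) : ℝ :=
  f (A ∪ {e}) - f A

/-- The gain reduction `GR(A, S, e) = MG(A, e) - MG(A ∪ S, e)`. -/
def gainReduction {N : Type*} [DecidableEq N] (f : Finset N → ℝ) (A S : Finset N) (e : N) : ℝ :=
  marginalGain f A e - marginalGain f (A ∪ S) e

/-- Second-order supermodularity: `GR(A, S, e) ≥ GR(B, S, e)` for all sets `A ⊆ B`, all sets `S`
disjoint from `B` and all elements `e`. -/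
def IsSecondOrderSupermodular {N : Type*} [DecidableEq N] (f : Finset N → ℝ) : Prop :=
  ∀ (A B S : Finset N) (e : N), A ⊆ B → Disjoint S B →
    gainReduction f B S e ≤ gainReduction f A S e

/-- An allocation gives every item to at most one agent; `none` means unallocated. -/
abbrev Allocation (N M : Type*) := N → Option M

/-- The set `A_ℓ` of the items that the allocation `A` gives to agent `ℓ`. -/
def Allocation.bundle {N M : Type*} [Fintype N] [DecidableEq M]
    (A : Allocation N M) (l : M) : Finset N :=
  {e : N | A e = some l}

/-- The social welfare `V(A) = ∑ ℓ, v_ℓ(A_ℓ)`. -/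
def welfare {N M : Type*} [Fintype N] [Fintype M] [DecidableEq M]
    (v : M → Finset N → ℝ) (A : Allocation N M) : ℝ :=
  ∑ l : M, v l (A.bundle l)

/-- `OPT`, the maximum social welfare over the (finitely many) allocations. -/
noncomputable def optWelfare {N M : Type*} [Fintype N] [Fintype M] [DecidableEq M]
    (v : M → Finset N → ℝ) : ℝ :=
  ⨆ A : Allocation N M, welfare v A

/-- An online rule: given the history `h` of the items that arrived before (most recent item
first) and the item `e` that arrives now, `r h e` is the agent that irrevocably gets `e`. -/
abbrev OnlineRule (N M : Type*) := List N → N → M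

/-- The allocation that the online rule `r` has produced after the history `h`
(most recent item first). -/
def OnlineRule.alloc {N M : Type*} [DecidableEq N] (r : OnlineRule N M) :
    List N → Allocation N M
  | [] => fun _ => none
  | e :: h => Function.update (OnlineRule.alloc r h) e (some (r h e))

/-- The rule `r` is a Greedy algorithm for the valuations `v`: after every history, every newly
arriving item is given to an agent with maximum marginal gain for it, with respect to the bundles
that the agents hold at that time. Ties may be broken in any way that depends on the history. -/
def OnlineRule.IsGreedy {N M : Type*} [Fintype N] [DecidableEq N] [DecidableEq M]
    (v : M → Finset N → ℝ) (r : OnlineRule N M) : Prop :=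
  ∀ (h : List N) (e : N), (e :: h).Nodup → ∀ l : M,
    marginalGain (v l) ((r.alloc h).bundle l) e ≤
      marginalGain (v (r h e)) ((r.alloc h).bundle (r h e)) e

/-- The final allocation of the rule `r` when the items arrive in the order
`σ 0, σ 1, …, σ (n - 1)`. -/
def OnlineRule.finalAlloc {N M : Type*} [Fintype N] [DecidableEq N] (r : OnlineRule N M)
    (σ : Fin (Fintype.card N) ≃ N) : Allocation N M :=
  r.alloc (List.ofFn σ).reverse

/-- The expected social welfare of the rule `r` in the random order model: the average over all
`n!` arrival orders of the `n` items. -/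
noncomputable def OnlineRule.expectedWelfare {N M : Type*} [Fintype N] [DecidableEq N] [Fintype M]
    [DecidableEq M] (v : M → Finset N → ℝ) (r : OnlineRule N M) : ℝ :=
  (∑ σ : Fin (Fintype.card N) ≃ N, welfare v (r.finalAlloc σ)) / ((Fintype.card N)! : ℝ)

end OnlineSWM

/-! ### Monotone submodular set functions. -/

section MonotoneSubmodular

variable {E ι : Type*} [DecidableEq E] [DecidableEq ι] {F : Finset E → ℝ}

/-! Let F be the value of a set of item-agent pairs (`jointValue`), again monotone and submodular, n
the number of items, and b_k Greedy's expected gain at position k. An arriving item brings Greedy at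
least as much as any single pair of that item would add to F. Fix at most β backup pairs for each
remaining item, and let R_k be the expected amount by which the backups of the items still missing
at time k would raise F. Then R_k ≤ β (n-k) b_k, and R_{k+1} ≥ (1 - 1/(n-k)) R_k - b_k
(`backupGain_le`, `backupGain_succ`).

With an optimal allocation O as backup and V = OPT - F(∅), this gives (n-k) b_k ≥ V - 2 Σ_{j<k} b_j
(`mul_meanGain_ge`), which alone yields the ratio 1/2.

The improvement uses a second backup. Cut the order at p and run Greedy on the late items alone, in
reverse order. That run is a prefix of a uniformly random order, so the early pairs of O add at most
p b_{n-p} to its result B in expectation. Hence B and the late part of O together retain V up to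
this loss, with two backup pairs per late item (`welfare_le_late`).

The rest is a linear program in the b_k. After padding to n = 4m items, `sum_gains_ge` sums the
second family of constraints over m < p ≤ 2m and 3m ≤ s < 4m and bounds the resulting slack by the
first family. This gives 49/96 > 0.5104. -/

theorem IsSubmodular.diminishing (hmono : Monotone F) (hsub : IsSubmodular F)
    {X Y : Finset E} (hXY : X ⊆ Y) (Z : Finset E) :
    F (Y ∪ Z) - F Y ≤ F (X ∪ Z) - F X := by
  have h1 := hsub Y (X ∪ Z)
  have h2 : Y ∪ (X ∪ Z) = Y ∪ Z := by
    rw [← union_assoc, union_eq_left.2 hXY]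
  have h3 : F X ≤ F (Y ∩ (X ∪ Z)) := hmono (subset_inter hXY subset_union_left)
  rw [h2] at h1
  linarith

theorem IsSubmodular.union_biUnion_le (hmono : Monotone F) (hsub : IsSubmodular F)
    (X : Finset E) (d : ι → Finset E) (I : Finset ι) :
    F (X ∪ I.biUnion d) - F X ≤ ∑ i ∈ I, (F (X ∪ d i) - F X) := by
  induction I using Finset.induction_on with
  | empty => simp
  | insert a I ha ih =>
    rw [sum_insert ha, biUnion_insert]
    have h := hsub.diminishing hmono (X := X) (Y := X ∪ I.biUnion d) subset_union_left (d a)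
    have h2 : X ∪ I.biUnion d ∪ d a = X ∪ (d a ∪ I.biUnion d) := by
      rw [union_assoc, union_comm (I.biUnion d)]
    rw [h2] at h
    linarith

/-- By diminishing returns, deleting one index from `I` costs no more than adding it cost in a chain
that builds up `I`. The deletion costs therefore sum to at most the whole increment, and a random
deletion loses at most a share 1/|I|. -/
theorem IsSubmodular.sum_erase_ge (hmono : Monotone F) (hsub : IsSubmodular F)
    (X : Finset E) (d : ι → Finset E) (I : Finset ι) :
    ((I.card : ℝ) - 1) * (F (X ∪ I.biUnion d) - F X) ≤
      ∑ i ∈ I, (F (X ∪ (I.erase i).biUnion d) - F X) := by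
  have key : ∀ J : Finset ι, J ⊆ I →
      ∑ i ∈ J, (F (X ∪ I.biUnion d) - F (X ∪ (I.erase i).biUnion d)) ≤
        F (X ∪ J.biUnion d) - F X := by
    intro J
    induction J using Finset.induction_on with
    | empty => simp
    | insert a J ha ih =>
      intro hJ
      have haI : a ∈ I := hJ (mem_insert_self a J)
      have hsubset : X ∪ J.biUnion d ⊆ X ∪ (I.erase a).biUnion d := by
        refine union_subset_union_right (biUnion_subset_biUnion_of_subset_left d ?_)
        intro i hi
        exact mem_erase.2 ⟨fun h => ha (h ▸ hi), hJ (mem_insert_of_mem hi)⟩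
      have h := hsub.diminishing hmono hsubset (d a)
      have h1 : X ∪ (I.erase a).biUnion d ∪ d a = X ∪ I.biUnion d := by
        rw [← insert_erase haI, biUnion_insert, erase_insert (notMem_erase a I), union_assoc,
          union_comm (d a)]
      have h2 : X ∪ J.biUnion d ∪ d a = X ∪ (insert a J).biUnion d := by
        rw [biUnion_insert, union_assoc, union_comm (d a)]
      rw [h1, h2] at h
      rw [sum_insert ha]
      have := ih ((subset_insert a J).trans hJ)
      linarith
  have h := key I Subset.rfl
  simp only [sum_sub_distrib, sum_const, nsmul_eq_mul] at h ⊢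
  linarith

end MonotoneSubmodular

/-! ### Welfare as a single set function on item-agent pairs. -/

section JointValue

set_option linter.unusedSectionVars false

variable {N M : Type*} [Fintype N] [DecidableEq N] [Fintype M] [DecidableEq M]

/-- The total value of a set of item-agent pairs. -/
def jointValue (v : M → Finset N → ℝ) (X : Finset (N × M)) : ℝ :=
  ∑ l : M, v l {e : N | (e, l) ∈ X}

/-- The item-agent pairs of an allocation. -/
def Allocation.graph (A : Allocation N M) : Finset (N × M) := {x | A x.1 = some x.2}

/-- The item-agent pairs of an allocation that belong to the item `e`. -/
def Allocation.pairs (A : Allocation N M) (e : N) : Finset (N × M) :=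
  {x | x.1 = e ∧ A e = some x.2}

theorem Allocation.mem_graph {A : Allocation N M} {x : N × M} :
    x ∈ A.graph ↔ A x.1 = some x.2 := by simp [Allocation.graph]

theorem Allocation.mem_pairs {A : Allocation N M} {e : N} {x : N × M} :
    x ∈ A.pairs e ↔ x.1 = e ∧ A e = some x.2 := by simp [Allocation.pairs]

theorem jointValue_graph (v : M → Finset N → ℝ) (A : Allocation N M) :
    jointValue v A.graph = welfare v A := by
  unfold jointValue welfare
  refine sum_congr rfl fun l _ => congrArg (v l) ?_
  ext e
  simp [Allocation.mem_graph, Allocation.bundle]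

theorem jointValue_monotone {v : M → Finset N → ℝ} (hv : ∀ l, Monotone (v l)) :
    Monotone (jointValue v) := by
  intro X Y hXY
  refine sum_le_sum fun l _ => hv l ?_
  intro e
  simp only [mem_filter, mem_univ, true_and]
  exact fun h => hXY h

theorem jointValue_isSubmodular {v : M → Finset N → ℝ} (hv : ∀ l, IsSubmodular (v l)) :
    IsSubmodular (jointValue v) := by
  intro X Y
  unfold jointValue
  rw [← sum_add_distrib, ← sum_add_distrib]
  refine sum_le_sum fun l _ => ?_
  have h := hv l {e : N | (e, l) ∈ X} {e : N | (e, l) ∈ Y}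
  have h1 : (univ.filter fun e : N => (e, l) ∈ X ∪ Y) =
      univ.filter (fun e : N => (e, l) ∈ X) ∪ univ.filter (fun e : N => (e, l) ∈ Y) := by
    ext e; simp
  have h2 : (univ.filter fun e : N => (e, l) ∈ X ∩ Y) =
      univ.filter (fun e : N => (e, l) ∈ X) ∩ univ.filter (fun e : N => (e, l) ∈ Y) := by
    ext e; simp
  rw [h1, h2]
  exact h

theorem jointValue_insert_sub (v : M → Finset N → ℝ) (A : Allocation N M) (e : N) (l : M) :
    jointValue v (insert (e, l) A.graph) - jointValue v A.graph =
      marginalGain (v l) (A.bundle l) e := by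
  unfold jointValue
  rw [← sum_sub_distrib, sum_eq_single l]
  · unfold marginalGain
    congr 2
    · ext x; simp [Allocation.mem_graph, Allocation.bundle]
    · ext x; simp [Allocation.mem_graph, Allocation.bundle]
  · intro k _ hk
    rw [sub_eq_zero]
    congr 1
    ext x; simp [hk]
  · simp

theorem OnlineRule.alloc_eq_none {r : OnlineRule N M} {h : List N} {e : N} (he : e ∉ h) :
    r.alloc h e = none := by
  induction h with
  | nil => rfl
  | cons x h ih =>
    simp only [List.mem_cons, not_or] at he
    simp [OnlineRule.alloc, Function.update_of_ne he.1, ih he.2]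

theorem OnlineRule.graph_alloc_nil (r : OnlineRule N M) : (r.alloc []).graph = ∅ := by
  ext x; simp [Allocation.mem_graph, OnlineRule.alloc]

theorem OnlineRule.graph_alloc_cons (r : OnlineRule N M) {h : List N} {e : N} (he : e ∉ h) :
    (r.alloc (e :: h)).graph = insert (e, r h e) (r.alloc h).graph := by
  ext ⟨x, l⟩
  simp only [Allocation.mem_graph, OnlineRule.alloc, mem_insert, Prod.mk.injEq]
  by_cases hx : x = e
  · subst hx
    simp [OnlineRule.alloc_eq_none he, eq_comm]
  · simp [hx]

/-- The gain of the rule `r` when the item `e` arrives after the history `h`. -/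
def OnlineRule.gain (v : M → Finset N → ℝ) (r : OnlineRule N M) (h : List N) (e : N) : ℝ :=
  jointValue v (insert (e, r h e) (r.alloc h).graph) - jointValue v (r.alloc h).graph

theorem OnlineRule.IsGreedy.insert_le {v : M → Finset N → ℝ} {r : OnlineRule N M}
    (hr : r.IsGreedy v) {h : List N} {e : N} (he : (e :: h).Nodup) (l : M) :
    jointValue v (insert (e, l) (r.alloc h).graph) - jointValue v (r.alloc h).graph ≤
      r.gain v h e := by
  unfold OnlineRule.gain
  rw [jointValue_insert_sub, jointValue_insert_sub]
  exact hr h e he l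

theorem OnlineRule.gain_nonneg {v : M → Finset N → ℝ} (hv : ∀ l, Monotone (v l))
    (r : OnlineRule N M) (h : List N) (e : N) : 0 ≤ r.gain v h e :=
  sub_nonneg.2 (jointValue_monotone hv (subset_insert _ _))

/-- A reference allocation has at most one pair per item, and Greedy's choice beats it; for an
unallocated item monotonicity suffices. -/
theorem OnlineRule.IsGreedy.union_pairs_le {v : M → Finset N → ℝ} (hv : ∀ l, Monotone (v l))
    {r : OnlineRule N M} (hr : r.IsGreedy v) {h : List N} {e : N} (he : (e :: h).Nodup)
    (A : Allocation N M) :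
    jointValue v ((r.alloc h).graph ∪ A.pairs e) - jointValue v (r.alloc h).graph ≤
      r.gain v h e := by
  rcases hA : A e with _ | l
  · have : A.pairs e = ∅ := by ext x; simp [Allocation.mem_pairs, hA]
    rw [this, union_empty, sub_self]
    exact r.gain_nonneg hv h e
  · have : A.pairs e = {(e, l)} := by
      ext ⟨x, k⟩
      simp [Allocation.mem_pairs, hA, eq_comm]
    rw [this, union_comm, ← insert_eq]
    exact hr.insert_le he l

end JointValue

/-! ### Random arrival orders and exchangeability. -/

section ArrivalOrders

open scoped BigOperators

set_option linter.unusedSectionVars false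

variable {N M : Type*} [Fintype N] [DecidableEq N] [Fintype M] [DecidableEq M] {n : ℕ}

/-- The first `k` items of an arrival order, most recent item first. -/
def arrivals (τ : Fin n ≃ N) : ℕ → List N
  | 0 => []
  | k + 1 => if hk : k < n then τ ⟨k, hk⟩ :: arrivals τ k else arrivals τ k

theorem arrivals_succ (τ : Fin n ≃ N) (k : Fin n) :
    arrivals τ (k + 1) = τ k :: arrivals τ k := by
  simp [arrivals]

theorem mem_arrivals {τ : Fin n ≃ N} {k : ℕ} {i : Fin n} :
    τ i ∈ arrivals τ k ↔ i.val < k := by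
  induction k with
  | zero => simp [arrivals]
  | succ k ih =>
    by_cases hk : k < n
    · simp only [arrivals, hk, dite_true, List.mem_cons, ih, EmbeddingLike.apply_eq_iff_eq,
        Fin.ext_iff]
      omega
    · simp only [arrivals, hk, dite_false, ih]
      have := i.isLt
      omega

theorem nodup_arrivals (τ : Fin n ≃ N) (k : ℕ) : (arrivals τ k).Nodup := by
  induction k with
  | zero => simp [arrivals]
  | succ k ih =>
    by_cases hk : k < n
    · simp only [arrivals, hk, dite_true, List.nodup_cons, ih, and_true]
      rw [mem_arrivals]
      simp
    · simpa only [arrivals, hk, dite_false] using ih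

theorem arrivals_congr {τ τ' : Fin n ≃ N} {k : ℕ} (h : ∀ i : Fin n, i.val < k → τ i = τ' i) :
    arrivals τ k = arrivals τ' k := by
  induction k with
  | zero => rfl
  | succ k ih =>
    have h1 := ih fun i hi => h i (hi.trans (Nat.lt_succ_self k))
    by_cases hk : k < n
    · simp only [arrivals, hk, dite_true, h1, h ⟨k, hk⟩ (Nat.lt_succ_self k)]
    · simp only [arrivals, hk, dite_false, h1]

theorem arrivals_eq_reverse_ofFn (τ : Fin n ≃ N) : arrivals τ n = (List.ofFn τ).reverse := by
  have key : ∀ k ≤ n, arrivals τ k = ((List.ofFn τ).take k).reverse := by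
    intro k
    induction k with
    | zero => simp [arrivals]
    | succ k ih =>
      intro hk
      have h : k < n := hk
      simp only [arrivals, h, dite_true]
      rw [ih h.le, List.take_add_one]
      simp [h]
  rw [key n le_rfl, List.take_of_length_le (by simp)]

/-- The items that are not in a history. -/
def remaining (h : List N) : Finset N := {e | e ∉ h}

theorem mem_remaining {h : List N} {e : N} : e ∈ remaining h ↔ e ∉ h := by
  simp [remaining]

theorem remaining_nil : remaining ([] : List N) = univ := by
  ext; simp [mem_remaining]

theorem remaining_cons (e : N) (h : List N) : remaining (e :: h) = (remaining h).erase e := by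
  ext x; simp [mem_remaining]

theorem remaining_arrivals (τ : Fin n ≃ N) (k : ℕ) :
    remaining (arrivals τ k) = (univ.filter fun i : Fin n => k ≤ i.val).map τ.toEmbedding := by
  ext x
  obtain ⟨i, rfl⟩ := τ.surjective x
  simp [mem_remaining, mem_arrivals]

theorem card_filter_le_fin {k : ℕ} (hk : k ≤ n) :
    (univ.filter fun i : Fin n => k ≤ i.val).card = n - k := by
  have h := Finset.card_filter_add_card_filter_not (s := (univ : Finset (Fin n)))
    (fun i : Fin n => i.val < k)
  simp only [not_lt, card_univ, Fintype.card_fin] at h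
  rw [Fin.card_filter_val_lt, min_eq_right hk] at h
  omega

theorem card_remaining_arrivals (τ : Fin n ≃ N) {k : ℕ} (hk : k ≤ n) :
    (remaining (arrivals τ k)).card = n - k := by
  rw [remaining_arrivals, card_map, card_filter_le_fin hk]

/-- A pair of arrival orders of the same items that agree on the first `p` positions: the first
one is `ω.1`, and the second one permutes its later positions by `ω.2`. -/
abbrev OrderPair (N : Type*) (n p : ℕ) :=
  (Fin n ≃ N) × {ρ : Equiv.Perm (Fin n) // ∀ i : Fin n, i.val < p → ρ i = i}

/-- The second arrival order of a pair. -/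
def OrderPair.second {p : ℕ} (ω : OrderPair N n p) : Fin n ≃ N := ω.2.1.trans ω.1

instance {p : ℕ} : Nonempty {ρ : Equiv.Perm (Fin n) // ∀ i : Fin n, i.val < p → ρ i = i} :=
  ⟨⟨1, fun _ _ => rfl⟩⟩

theorem OrderPair.arrivals_second {p k : ℕ} (ω : OrderPair N n p) (hk : k ≤ p) :
    arrivals ω.second k = arrivals ω.1 k :=
  arrivals_congr fun i hi => congrArg ω.1 (ω.2.2 i (hi.trans_le hk))

/-- Exchanging two late positions of the second order. -/
def OrderPair.swap {p : ℕ} (k j : Fin n) (hk : p ≤ k.val) (hj : p ≤ j.val) :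
    Equiv.Perm (OrderPair N n p) :=
  Function.Involutive.toPerm
    (fun ω => (ω.1, ⟨(Equiv.swap k j).trans ω.2.1, fun i hi => by
      have hik : i ≠ k := fun h => by subst h; omega
      have hij : i ≠ j := fun h => by subst h; omega
      simp [Equiv.swap_apply_of_ne_of_ne hik hij, ω.2.2 i hi]⟩))
    (fun ω => by
      refine Prod.ext rfl (Subtype.ext ?_)
      ext i
      simp)

theorem OrderPair.swap_second_apply {p : ℕ} {k j : Fin n} (hk : p ≤ k.val) (hj : p ≤ j.val)
    (ω : OrderPair N n p) (i : Fin n) :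
    (OrderPair.swap k j hk hj ω).second i = ω.second (Equiv.swap k j i) := rfl

/-- For each fixed `ρ`, precomposition is a bijection of the orders, so the second order is uniform
as well. -/
theorem OrderPair.expect_second {p : ℕ} (f : (Fin n ≃ N) → ℝ) :
    𝔼 ω : OrderPair N n p, f ω.second = 𝔼 τ : Fin n ≃ N, f τ := by
  have h : ∀ ρ : {ρ : Equiv.Perm (Fin n) // ∀ i : Fin n, i.val < p → ρ i = i},
      𝔼 σ : Fin n ≃ N, f (ρ.1.trans σ) = 𝔼 τ : Fin n ≃ N, f τ := by
    intro ρ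
    refine Fintype.expect_equiv
      ⟨fun σ => ρ.1.trans σ, fun σ => ρ.1.symm.trans σ, fun σ => ?_, fun σ => ?_⟩ _ _ fun σ => rfl
    · ext i; simp
    · ext i; simp
  calc 𝔼 ω : OrderPair N n p, f ω.second
      = 𝔼 σ : Fin n ≃ N, 𝔼 ρ : {ρ : Equiv.Perm (Fin n) // ∀ i : Fin n, i.val < p → ρ i = i},
          f (ρ.1.trans σ) := by
        rw [← univ_product_univ, expect_product]
        rfl
    _ = 𝔼 τ : Fin n ≃ N, f τ := by
        rw [expect_comm, expect_congr rfl fun ρ _ => h ρ, Fintype.expect_const]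

theorem OrderPair.expect_first {p : ℕ} (f : (Fin n ≃ N) → ℝ) :
    𝔼 ω : OrderPair N n p, f ω.1 = 𝔼 τ : Fin n ≃ N, f τ := by
  rw [← univ_product_univ, expect_product]
  exact expect_congr rfl fun σ _ => Fintype.expect_const (f σ)

/-- Given the past, the next item of the second order is uniformly random. -/
theorem OrderPair.expect_exchange {p : ℕ} (k : Fin n) (hk : p ≤ k.val)
    (g : (Fin n ≃ N) → List N → N → ℝ) :
    ((n : ℝ) - k) * 𝔼 ω : OrderPair N n p, g ω.1 (arrivals ω.second k) (ω.second k) =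
      𝔼 ω : OrderPair N n p, ∑ x ∈ remaining (arrivals ω.second k),
        g ω.1 (arrivals ω.second k) x := by
  -- Swapping positions `k` and `j ≥ k` of the second order changes neither `ω.1` nor the first `k`
  -- arrivals, so all remaining items are equally likely to come next, even given `ω.1`.
  have h : ∀ j : Fin n, k.val ≤ j.val →
      𝔼 ω : OrderPair N n p, g ω.1 (arrivals ω.second k) (ω.second j) =
        𝔼 ω : OrderPair N n p, g ω.1 (arrivals ω.second k) (ω.second k) := by
    intro j hj
    refine Fintype.expect_equiv (OrderPair.swap k j hk (hk.trans hj)) _ _ fun ω => ?_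
    have h1 : arrivals (OrderPair.swap k j hk (hk.trans hj) ω).second k =
        arrivals ω.second k := by
      refine arrivals_congr fun i hi => ?_
      have hik : i ≠ k := fun h => by subst h; omega
      have hij : i ≠ j := fun h => by subst h; omega
      rw [OrderPair.swap_second_apply, Equiv.swap_apply_of_ne_of_ne hik hij]
    rw [h1, OrderPair.swap_second_apply, Equiv.swap_apply_left]
    rfl
  simp only [remaining_arrivals, sum_map, Equiv.coe_toEmbedding]
  rw [expect_sum_comm, sum_congr rfl fun j hj => h j (mem_filter.1 hj).2, sum_const,
    card_filter_le_fin k.isLt.le, nsmul_eq_mul, Nat.cast_sub k.isLt.le]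

end ArrivalOrders

/-! ### Backup pairs and expected gains. -/

section RandomOrder

open scoped BigOperators

set_option linter.unusedSectionVars false

variable {N M : Type*} [Fintype N] [DecidableEq N] [Fintype M] [DecidableEq M] {n : ℕ}

/-- The expected gain of the rule `r` from the item at position `k` of a random order. -/
noncomputable def OnlineRule.meanGain (v : M → Finset N → ℝ) (r : OnlineRule N M) (n k : ℕ) : ℝ :=
  if hk : k < n then 𝔼 τ : Fin n ≃ N, r.gain v (arrivals τ k) (τ ⟨k, hk⟩) else 0

/-- The value of the pairs that the rule `r` holds after the history `h`. -/
def OnlineRule.value (v : M → Finset N → ℝ) (r : OnlineRule N M) (h : List N) : ℝ :=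
  jointValue v (r.alloc h).graph

/-- The expected amount by which the backup pairs `c` of the items that have not arrived before
position `k` would increase the value. -/
noncomputable def OnlineRule.backupGain (v : M → Finset N → ℝ) (r : OnlineRule N M) (n p : ℕ)
    (c : (Fin n ≃ N) → N → Finset (N × M)) (k : ℕ) : ℝ :=
  𝔼 ω : OrderPair N n p,
    (jointValue v ((r.alloc (arrivals ω.second k)).graph ∪
      (remaining (arrivals ω.second k)).biUnion (c ω.1)) - r.value v (arrivals ω.second k))

variable {v : M → Finset N → ℝ} {r : OnlineRule N M}

theorem nodup_cons_arrivals (τ : Fin n ≃ N) (k : Fin n) : (τ k :: arrivals τ k).Nodup := by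
  rw [← arrivals_succ]
  exact nodup_arrivals τ _

theorem OnlineRule.value_cons {h : List N} {e : N} (he : e ∉ h) :
    r.value v (e :: h) = r.value v h + r.gain v h e := by
  unfold OnlineRule.value OnlineRule.gain
  rw [OnlineRule.graph_alloc_cons r he]
  ring

theorem OnlineRule.meanGain_nonneg (hv : ∀ l, Monotone (v l)) (k : ℕ) :
    0 ≤ r.meanGain v n k := by
  unfold OnlineRule.meanGain
  split_ifs
  · exact expect_nonneg fun τ _ => r.gain_nonneg hv _ _
  · exact le_rfl

theorem OnlineRule.meanGain_eq_second (p : ℕ) (k : Fin n) :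
    r.meanGain v n k =
      𝔼 ω : OrderPair N n p, r.gain v (arrivals ω.second k) (ω.second k) := by
  unfold OnlineRule.meanGain
  rw [dif_pos k.isLt]
  exact (OrderPair.expect_second fun τ => r.gain v (arrivals τ k) (τ k)).symm

theorem OnlineRule.expect_value_arrivals [Nonempty (Fin n ≃ N)] {k : ℕ} (hk : k ≤ n) :
    𝔼 τ : Fin n ≃ N, r.value v (arrivals τ k) =
      jointValue v ∅ + ∑ j ∈ range k, r.meanGain v n j := by
  induction k with
  | zero =>
    simp only [arrivals, OnlineRule.value, OnlineRule.graph_alloc_nil]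
    simp
  | succ k ih =>
    have hkn : k < n := hk
    have h : ∀ τ : Fin n ≃ N, r.value v (arrivals τ (k + 1)) =
        r.value v (arrivals τ k) + r.gain v (arrivals τ k) (τ ⟨k, hkn⟩) := by
      intro τ
      have h1 := nodup_cons_arrivals τ ⟨k, hkn⟩
      rw [arrivals_succ τ ⟨k, hkn⟩, OnlineRule.value_cons (List.nodup_cons.1 h1).1]
    rw [expect_congr rfl fun τ _ => h τ, expect_add_distrib, ih hkn.le, sum_range_succ,
      OnlineRule.meanGain, dif_pos hkn, add_assoc]

/-- Submodularity bounds the joint contribution by the sum of the separate ones. Each is at most `β`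
times the gain if that item came next, and the next item is uniform among the `n - k` remaining
ones. -/
theorem OnlineRule.backupGain_le (hv : ∀ l, Monotone (v l)) (hs : ∀ l, IsSubmodular (v l))
    {p : ℕ} {c : (Fin n ≃ N) → N → Finset (N × M)} {β : ℝ}
    (hc : ∀ σ h e, (e :: h).Nodup →
      jointValue v ((r.alloc h).graph ∪ c σ e) - r.value v h ≤ β * r.gain v h e)
    {k : ℕ} (hp : p ≤ k) (hk : k < n) :
    r.backupGain v n p c k ≤ β * (((n : ℝ) - k) * r.meanGain v n k) := by
  have h1 := OrderPair.expect_exchange (N := N) (n := n) (p := p) ⟨k, hk⟩ hp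
    fun _ h x => r.gain v h x
  rw [OnlineRule.meanGain_eq_second p ⟨k, hk⟩]
  simp only at h1 ⊢
  rw [h1, mul_expect]
  refine expect_le_expect fun ω _ => ?_
  refine ((jointValue_isSubmodular hs).union_biUnion_le (jointValue_monotone hv) _ _ _).trans ?_
  rw [mul_sum]
  refine sum_le_sum fun x hx => hc _ _ _ ?_
  exact List.nodup_cons.2 ⟨mem_remaining.1 hx, nodup_arrivals _ _⟩

/-- There are two losses: the arriving item takes its backup along, on average a share 1/(n-k) by
`sum_erase_ge`, and the value already held grows by the mean gain. By monotonicity, the new pair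
does not lower the value of the union. -/
theorem OnlineRule.backupGain_succ (hv : ∀ l, Monotone (v l)) (hs : ∀ l, IsSubmodular (v l))
    {p : ℕ} (c : (Fin n ≃ N) → N → Finset (N × M)) {k : ℕ} (hp : p ≤ k) (hk : k < n) :
    ((n : ℝ) - k - 1) * r.backupGain v n p c k - ((n : ℝ) - k) * r.meanGain v n k ≤
      ((n : ℝ) - k) * r.backupGain v n p c (k + 1) := by
  have hnk : (0 : ℝ) ≤ (n : ℝ) - k := sub_nonneg.2 (Nat.cast_le.2 hk.le)
  have hmono := jointValue_monotone hv
  have hsub := jointValue_isSubmodular hs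
  set g : (Fin n ≃ N) → List N → N → ℝ := fun σ h x =>
    jointValue v ((r.alloc h).graph ∪ ((remaining h).erase x).biUnion (c σ)) - r.value v h
  have h1 : 𝔼 ω : OrderPair N n p, g ω.1 (arrivals ω.second k) (ω.second ⟨k, hk⟩) -
      r.meanGain v n k ≤ r.backupGain v n p c (k + 1) := by
    rw [OnlineRule.meanGain_eq_second p ⟨k, hk⟩, ← expect_sub_distrib]
    refine expect_le_expect fun ω _ => ?_
    have hnd := nodup_cons_arrivals ω.second ⟨k, hk⟩
    rw [arrivals_succ ω.second ⟨k, hk⟩, OnlineRule.value_cons (List.nodup_cons.1 hnd).1,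
      OnlineRule.graph_alloc_cons r (List.nodup_cons.1 hnd).1, remaining_cons]
    have h2 : jointValue v ((r.alloc (arrivals ω.second k)).graph ∪
        ((remaining (arrivals ω.second k)).erase (ω.second ⟨k, hk⟩)).biUnion (c ω.1)) ≤
        jointValue v (insert (ω.second ⟨k, hk⟩, r (arrivals ω.second k) (ω.second ⟨k, hk⟩))
          (r.alloc (arrivals ω.second k)).graph ∪
        ((remaining (arrivals ω.second k)).erase (ω.second ⟨k, hk⟩)).biUnion (c ω.1)) :=
      hmono (union_subset_union_left (subset_insert _ _))
    simp only [g]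
    linarith
  have h3 := OrderPair.expect_exchange (N := N) (n := n) (p := p) ⟨k, hk⟩ hp g
  have h4 : ((n : ℝ) - k - 1) * r.backupGain v n p c k ≤
      𝔼 ω : OrderPair N n p, ∑ x ∈ remaining (arrivals ω.second k),
        g ω.1 (arrivals ω.second k) x := by
    unfold OnlineRule.backupGain
    rw [mul_expect]
    refine expect_le_expect fun ω _ => ?_
    have h5 := hsub.sum_erase_ge hmono (r.alloc (arrivals ω.second k)).graph (c ω.1)
      (remaining (arrivals ω.second k))
    rwa [card_remaining_arrivals _ hk.le, Nat.cast_sub hk.le] at h5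
  simp only at h3
  rw [← h3] at h4
  have h6 := mul_le_mul_of_nonneg_left h1 hnk
  linarith

/-- The guarantee that greedy gets from the remaining part of a reference allocation. -/
theorem OnlineRule.IsGreedy.mul_meanGain_ge [Nonempty (Fin n ≃ N)] (hr : r.IsGreedy v)
    (hv : ∀ l, Monotone (v l)) (hs : ∀ l, IsSubmodular (v l)) (O : Allocation N M) {k : ℕ}
    (hk : k < n) :
    welfare v O - jointValue v ∅ - 2 * ∑ j ∈ range k, r.meanGain v n j ≤
      ((n : ℝ) - k) * r.meanGain v n k := by
  set c : (Fin n ≃ N) → N → Finset (N × M) := fun _ => O.pairs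
  have hc : ∀ (σ : Fin n ≃ N) (h : List N) (e : N), (e :: h).Nodup →
      jointValue v ((r.alloc h).graph ∪ c σ e) - r.value v h ≤ 1 * r.gain v h e := by
    intro σ h e he
    rw [one_mul]
    exact hr.union_pairs_le hv he O
  -- The share lost with the arriving item is at most one mean gain by `backupGain_le`, so each step
  -- costs two in all. The backup is deterministic, so the cut is at 0.
  have key : ∀ j, j < n → welfare v O - jointValue v ∅ - 2 * ∑ i ∈ range j, r.meanGain v n i ≤
      r.backupGain v n 0 c j := by
    intro j
    induction j with
    | zero =>
      intro _
      have h1 : ∀ ω : OrderPair N n 0,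
          jointValue v ((r.alloc (arrivals ω.second 0)).graph ∪
            (remaining (arrivals ω.second 0)).biUnion (c ω.1)) - r.value v (arrivals ω.second 0) =
          welfare v O - jointValue v ∅ := by
        intro ω
        have h2 : (univ : Finset N).biUnion O.pairs = O.graph := by
          ext x; simp [Allocation.mem_pairs, Allocation.mem_graph]
        simp only [arrivals, OnlineRule.value, OnlineRule.graph_alloc_nil, remaining_nil, c,
          empty_union, h2, jointValue_graph]
      unfold OnlineRule.backupGain
      rw [expect_congr rfl fun ω _ => h1 ω, expect_const univ_nonempty]
      simp
    | succ j ih =>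
      intro hj
      have hjn : j < n := (Nat.lt_succ_self j).trans hj
      have h1 := ih hjn
      have h2 := OnlineRule.backupGain_succ (r := r) hv hs c (Nat.zero_le j) hjn
      have h3 := OnlineRule.backupGain_le hv hs hc (Nat.zero_le j) hjn
      have hpos : (0 : ℝ) < (n : ℝ) - j := sub_pos.2 (Nat.cast_lt.2 hjn)
      rw [sum_range_succ]
      have h4 : ((n : ℝ) - j) * (r.backupGain v n 0 c j - 2 * r.meanGain v n j) ≤
          ((n : ℝ) - j) * r.backupGain v n 0 c (j + 1) := by linarith
      have h5 := le_of_mul_le_mul_left h4 hpos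
      linarith
  have h := OnlineRule.backupGain_le hv hs hc (Nat.zero_le k) hk
  linarith [key k hk]

end RandomOrder

/-! ### A backup from running Greedy on the late items in reverse. -/

section BackupSolution

open scoped BigOperators

set_option linter.unusedSectionVars false

variable {N M : Type*} [Fintype N] [DecidableEq N] [Fintype M] [DecidableEq M] {n : ℕ}
  {v : M → Finset N → ℝ} {r : OnlineRule N M}

/-- The allocation that the rule `r` produces when the items after the first `p` ones arrive
alone, in reverse order. -/
def OnlineRule.reverseAlloc (r : OnlineRule N M) (p : ℕ) (σ : Fin n ≃ N) : Allocation N M :=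
  r.alloc (arrivals (Fin.revPerm.trans σ) (n - p))

theorem mem_arrivals_rev {p : ℕ} (hp : p ≤ n) (σ : Fin n ≃ N) (i : Fin n) :
    σ i ∈ arrivals (Fin.revPerm.trans σ) (n - p) ↔ p ≤ i.val := by
  have h : σ i = (Fin.revPerm.trans σ) (Fin.rev i) := by simp
  rw [h, mem_arrivals, Fin.val_rev]
  have := i.isLt
  omega

/-- The early pairs of `O` add no more to the reverse run together with the late pairs of `O` than
to the reverse run alone. The set `X` enters only by monotonicity. -/
theorem welfare_le_backup (hv : ∀ l, Monotone (v l)) (hs : ∀ l, IsSubmodular (v l))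
    (O : Allocation N M) {p : ℕ} (hp : p ≤ n) (σ : Fin n ≃ N) (X : Finset (N × M)) :
    welfare v O - (jointValue v ((r.reverseAlloc p σ).graph ∪
        (remaining (arrivals (Fin.revPerm.trans σ) (n - p))).biUnion O.pairs) -
          jointValue v (r.reverseAlloc p σ).graph) ≤
      jointValue v (X ∪ (remaining (arrivals σ p)).biUnion
        fun e => O.pairs e ∪ (r.reverseAlloc p σ).pairs e) := by
  set B := r.reverseAlloc p σ with hB
  have hmono := jointValue_monotone hv
  set Y := B.graph ∪ (remaining (arrivals σ p)).biUnion O.pairs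
  have h1 := (jointValue_isSubmodular hs).diminishing hmono (X := B.graph) (Y := Y)
    subset_union_left ((remaining (arrivals (Fin.revPerm.trans σ) (n - p))).biUnion O.pairs)
  have h2 : welfare v O ≤ jointValue v
      (Y ∪ (remaining (arrivals (Fin.revPerm.trans σ) (n - p))).biUnion O.pairs) := by
    rw [← jointValue_graph]
    refine hmono fun x hx => ?_
    obtain ⟨e, l⟩ := x
    obtain ⟨i, rfl⟩ := σ.surjective e
    rw [Allocation.mem_graph] at hx
    simp only [Y, mem_union, mem_biUnion, Allocation.mem_pairs, mem_remaining]
    by_cases hi : p ≤ i.val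
    · exact Or.inl (Or.inr ⟨σ i, by rw [mem_arrivals]; omega, rfl, hx⟩)
    · exact Or.inr ⟨σ i, by rwa [mem_arrivals_rev hp], rfl, hx⟩
  have h3 : jointValue v Y ≤ jointValue v (X ∪ (remaining (arrivals σ p)).biUnion
        fun e => O.pairs e ∪ B.pairs e) := by
    refine hmono fun x hx => ?_
    obtain ⟨e, l⟩ := x
    obtain ⟨i, rfl⟩ := σ.surjective e
    simp only [Y, mem_union, mem_biUnion, Allocation.mem_pairs, mem_remaining,
      Allocation.mem_graph] at hx ⊢
    rcases hx with hx | ⟨a, ha, hx⟩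
    · refine Or.inr ⟨σ i, ?_, Or.inr ⟨rfl, hx⟩⟩
      rw [mem_arrivals, not_lt, ← mem_arrivals_rev hp σ]
      by_contra hcon
      rw [hB, OnlineRule.reverseAlloc, OnlineRule.alloc_eq_none hcon] at hx
      cases hx
    · exact Or.inr ⟨a, ha, Or.inl hx⟩
  linarith

theorem OnlineRule.IsGreedy.backupGain_const_le (hr : r.IsGreedy v)
    (hv : ∀ l, Monotone (v l)) (hs : ∀ l, IsSubmodular (v l)) (O : Allocation N M) {q : ℕ}
    (hq : q < n) :
    𝔼 τ : Fin n ≃ N, (jointValue v ((r.alloc (arrivals τ q)).graph ∪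
        (remaining (arrivals τ q)).biUnion O.pairs) - r.value v (arrivals τ q)) ≤
      ((n : ℝ) - q) * r.meanGain v n q := by
  have h := OnlineRule.backupGain_le (r := r) (p := 0) (c := fun _ => O.pairs) (β := 1) hv hs
    (fun σ h e he => by
      rw [one_mul]
      exact hr.union_pairs_le hv he O) (Nat.zero_le q) hq
  rw [one_mul] at h
  refine le_of_eq_of_le ?_ h
  exact (OrderPair.expect_second fun τ => jointValue v ((r.alloc (arrivals τ q)).graph ∪
        (remaining (arrivals τ q)).biUnion O.pairs) - r.value v (arrivals τ q)).symm

/-- Reversing a uniform order gives a uniform order, so what `O` can still add after the reverse run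
has the same mean as after Greedy's first `n - p` arrivals. Both orders of a pair share the first
`p` items, hence also the value held at the cut. -/
theorem OnlineRule.IsGreedy.welfare_le_backupGain [Nonempty (Fin n ≃ N)] (hr : r.IsGreedy v)
    (hv : ∀ l, Monotone (v l)) (hs : ∀ l, IsSubmodular (v l)) (O : Allocation N M) {p : ℕ}
    (hp : 0 < p) (hpn : p < n) :
    welfare v O - jointValue v ∅ - p * r.meanGain v n (n - p) -
        ∑ j ∈ range p, r.meanGain v n j ≤
      r.backupGain v n p (fun σ e => O.pairs e ∪ (r.reverseAlloc p σ).pairs e) p := by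
  set D : (Fin n ≃ N) → ℝ := fun τ => jointValue v ((r.alloc (arrivals τ (n - p))).graph ∪
        (remaining (arrivals τ (n - p))).biUnion O.pairs) - r.value v (arrivals τ (n - p))
  have h1 : 𝔼 τ, D τ ≤ p * r.meanGain v n (n - p) := by
    have h := hr.backupGain_const_le hv hs O (Nat.sub_lt (hp.trans hpn) hp)
    rw [Nat.cast_sub hpn.le, sub_sub_cancel] at h
    exact h
  have h2 : 𝔼 σ : Fin n ≃ N, D (Fin.revPerm.trans σ) = 𝔼 τ, D τ :=
    Fintype.expect_equiv
      ⟨fun σ => Fin.revPerm.trans σ, fun σ => Fin.revPerm.trans σ, fun σ => by ext i; simp,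
        fun σ => by ext i; simp⟩ _ _ fun σ => rfl
  have h3 : 𝔼 σ : Fin n ≃ N, (welfare v O - D (Fin.revPerm.trans σ) - r.value v (arrivals σ p)) ≤
      r.backupGain v n p (fun σ e => O.pairs e ∪ (r.reverseAlloc p σ).pairs e) p := by
    rw [← OrderPair.expect_first (p := p)]
    refine expect_le_expect fun ω _ => ?_
    rw [OrderPair.arrivals_second ω le_rfl]
    have h4 := welfare_le_backup (r := r) hv hs O hpn.le ω.1 (r.alloc (arrivals ω.1 p)).graph
    exact sub_le_sub_right h4 _
  rw [expect_sub_distrib, expect_sub_distrib, h2, expect_const univ_nonempty,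
    OnlineRule.expect_value_arrivals hpn.le] at h3
  linarith

/-- The guarantee that greedy gets when it can choose between a reference allocation and its own
allocation of the late items. -/
theorem OnlineRule.IsGreedy.welfare_le_late [Nonempty (Fin n ≃ N)] (hr : r.IsGreedy v)
    (hv : ∀ l, Monotone (v l)) (hs : ∀ l, IsSubmodular (v l)) (O : Allocation N M) {p s : ℕ}
    (hp : 0 < p) (hps : p ≤ s) (hsn : s < n) :
    welfare v O - jointValue v ∅ ≤
      ((n : ℝ) - p) * (2 * r.meanGain v n s +
        ∑ k ∈ Ico p s, r.meanGain v n k / ((n : ℝ) - k - 1)) +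
      p * r.meanGain v n (n - p) + ∑ j ∈ range p, r.meanGain v n j := by
  -- The backup is read off the first order, while Greedy is followed on the second, whose late
  -- positions are shuffled independently; so the next item stays uniform given the backup.
  set c : (Fin n ≃ N) → N → Finset (N × M) :=
    fun σ e => O.pairs e ∪ (r.reverseAlloc p σ).pairs e
  have hmono := jointValue_monotone hv
  have hc : ∀ (σ : Fin n ≃ N) (h : List N) (e : N), (e :: h).Nodup →
      jointValue v ((r.alloc h).graph ∪ c σ e) - r.value v h ≤ 2 * r.gain v h e := by
    intro σ h e he
    have h1 := hr.union_pairs_le hv he O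
    have h2 := hr.union_pairs_le hv he (r.reverseAlloc p σ)
    have h3 := (jointValue_isSubmodular hs).diminishing hmono
      (X := (r.alloc h).graph) (Y := (r.alloc h).graph ∪ O.pairs e) subset_union_left
      ((r.reverseAlloc p σ).pairs e)
    rw [union_assoc] at h3
    simp only [OnlineRule.value, c]
    linarith
  -- Division by `(n - j) * (n - j - 1)` turns the recursion of `backupGain_succ` into a telescoping
  -- one.
  have key : ∀ j, p ≤ j → j < n →
      r.backupGain v n p c p / ((n : ℝ) - p) -
        ∑ k ∈ Ico p j, r.meanGain v n k / ((n : ℝ) - k - 1) ≤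
      r.backupGain v n p c j / ((n : ℝ) - j) := by
    intro j hpj
    induction j, hpj using Nat.le_induction with
    | base => intro _; simp
    | succ j hpj ih =>
      intro hj
      have hjn : j < n := (Nat.lt_succ_self j).trans hj
      have h1 := ih hjn
      have h2 := OnlineRule.backupGain_succ (r := r) hv hs c hpj hjn
      have hpos : (0 : ℝ) < (n : ℝ) - j := sub_pos.2 (Nat.cast_lt.2 hjn)
      have hpos' : (0 : ℝ) < (n : ℝ) - j - 1 := by
        have : ((j + 1 : ℕ) : ℝ) < n := Nat.cast_lt.2 hj
        push_cast at this
        linarith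
      rw [sum_Ico_succ_top hpj]
      have h3 : r.backupGain v n p c j / ((n : ℝ) - j) - r.meanGain v n j / ((n : ℝ) - j - 1) ≤
          r.backupGain v n p c (j + 1) / ((n : ℝ) - (j + 1 : ℕ)) := by
        push_cast
        rw [← sub_sub, div_sub_div _ _ hpos.ne' hpos'.ne', div_le_div_iff₀ (mul_pos hpos hpos') hpos']
        have := mul_le_mul_of_nonneg_right h2 hpos'.le
        linarith
      linarith
  have h1 := key s hps hsn
  have h2 := OnlineRule.backupGain_le hv hs hc hps hsn
  have h3 := hr.welfare_le_backupGain hv hs O hp (hps.trans_lt hsn)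
  have hpos : (0 : ℝ) < (n : ℝ) - s := sub_pos.2 (Nat.cast_lt.2 hsn)
  have hpos' : (0 : ℝ) < (n : ℝ) - p := sub_pos.2 (Nat.cast_lt.2 (hps.trans_lt hsn))
  have h4 : r.backupGain v n p c s / ((n : ℝ) - s) ≤ 2 * r.meanGain v n s := by
    rw [div_le_iff₀ hpos]
    linarith
  have h5 : r.backupGain v n p c p / ((n : ℝ) - p) ≤ 2 * r.meanGain v n s +
        ∑ k ∈ Ico p s, r.meanGain v n k / ((n : ℝ) - k - 1) := by linarith
  rw [div_le_iff₀ hpos'] at h5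
  linarith

end BackupSolution

/-! ### The factor-revealing linear program. -/

section FactorRevealing

/-- A lower bound for weighted sums of gains `β x`, where `x + 1` items remain and `e (x + 1)` is
half of the missing welfare, propagated along a segment of the arrival sequence. -/
theorem weighted_gain_segment {e β c Θ : ℕ → ℝ} {t₀ t₁ : ℕ} (ht₀ : 0 < t₀) (ht : t₀ ≤ t₁)
    (hone : t₀ = 1 → Θ 1 = 0 ∧ 0 ≤ c 1)
    (he : ∀ x, t₀ ≤ x → x < t₁ → e x = e (x + 1) - β x)
    (hβ : ∀ x, t₀ ≤ x → x < t₁ → 2 * e (x + 1) ≤ ((x : ℝ) + 1) * β x)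
    (hΘ : ∀ x, t₀ ≤ x → x < t₁ → Θ (x + 1) = Θ x + 2 * (x * c x))
    (hc : ∀ x, t₀ ≤ x → x < t₁ → Θ x ≤ x * c x * ((x : ℝ) - 1)) {P : ℝ}
    (h₀ : Θ t₀ / ((t₀ : ℝ) * (t₀ - 1)) * e t₀ ≤ P) :
    Θ t₁ / ((t₁ : ℝ) * (t₁ - 1)) * e t₁ ≤ P + ∑ x ∈ Ico t₀ t₁, c x * β x := by
  induction t₁, ht using Nat.le_induction with
  | base => simpa using h₀
  | succ t htt ih =>
    have h1 := ih (fun x h h' => he x h (h'.trans (Nat.lt_succ_self t)))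
      (fun x h h' => hβ x h (h'.trans (Nat.lt_succ_self t)))
      (fun x h h' => hΘ x h (h'.trans (Nat.lt_succ_self t)))
      (fun x h h' => hc x h (h'.trans (Nat.lt_succ_self t)))
    have he' := he t htt (Nat.lt_succ_self t)
    have hβ' := hβ t htt (Nat.lt_succ_self t)
    have hΘ' := hΘ t htt (Nat.lt_succ_self t)
    have hc' := hc t htt (Nat.lt_succ_self t)
    have htpos : (0 : ℝ) < t := Nat.cast_pos.2 (ht₀.trans_le htt)
    rw [sum_Ico_succ_top htt, ← add_assoc]
    -- The induction runs backwards in time. Replace `e t` by `e (t + 1) - β t` and spend the excess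
    -- `c t - θ ≥ 0` on the lower bound for `β t`: the coefficient becomes `θ + 2 * (c t - θ) / (t +
    -- 1)`, which times `t * (t + 1)` is the recursion for `Θ`. At `t = 1` the quotient is a
    -- division by zero, which `hone` covers.
    obtain ⟨θ, hθ, hθ2⟩ : ∃ θ : ℝ, θ = Θ t / ((t : ℝ) * (t - 1)) ∧ θ * (t * (t - 1)) = Θ t := by
      refine ⟨_, rfl, ?_⟩
      rcases eq_or_ne ((t : ℝ) - 1) 0 with h | h
      · have h2 : t = 1 := by
          have : (t : ℝ) = 1 := by linarith
          exact_mod_cast this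
        have h3 : t₀ = 1 := by omega
        rw [h2, (hone h3).1]
        simp
      · field_simp
    have hθc : θ ≤ c t := by
      rcases eq_or_ne ((t : ℝ) - 1) 0 with h | h
      · have h4 : θ = 0 := by rw [hθ, h]; simp
        have h2 : t = 1 := by
          have : (t : ℝ) = 1 := by linarith
          exact_mod_cast this
        rw [h4, h2]
        exact (hone (by omega)).2
      · have h5 : (0 : ℝ) < (t : ℝ) - 1 := by
          have : (1 : ℝ) ≤ t := by exact_mod_cast ht₀.trans_le htt
          exact lt_of_le_of_ne (by linarith) h.symm
        rw [← hθ2] at hc'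
        have h6 : θ * (t * (t - 1)) ≤ c t * (t * (t - 1)) := by linarith
        exact le_of_mul_le_mul_right h6 (mul_pos htpos h5)
    have h7 : Θ (t + 1) / (((t + 1 : ℕ) : ℝ) * ((t + 1 : ℕ) - 1)) * e (t + 1) =
        (c t - θ) * (2 * e (t + 1) / (t + 1)) + θ * e (t + 1) := by
      rw [hΘ', ← hθ2]
      have h9 : (((t + 1 : ℕ) : ℝ) * ((t + 1 : ℕ) - 1)) = ((t : ℝ) + 1) * t := by
        push_cast
        ring
      have htne : (t : ℝ) ≠ 0 := htpos.ne'
      rw [h9]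
      field_simp
      ring
    have h8 : (c t - θ) * (2 * e (t + 1) / (t + 1)) ≤ (c t - θ) * β t := by
      refine mul_le_mul_of_nonneg_left ?_ (sub_nonneg.2 hθc)
      rw [div_le_iff₀ (by positivity)]
      linarith
    rw [h7]
    rw [← hθ, he'] at h1
    linarith

theorem sum_Ioc_four_mul_sub {m k : ℕ} (hk : m ≤ k) :
    ∑ p ∈ Ioc m k, (4 * (m : ℝ) - p) =
      (3 * m * (3 * m - 1) - (4 * m - k) * (4 * m - k - 1)) / 2 := by
  induction k, hk using Nat.le_induction with
  | base => simp; ring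
  | succ k hk ih =>
    rw [Finset.sum_Ioc_succ_top (by omega), ih]
    push_cast
    ring

/-- The total weight, over the cut positions `p`, of the item after which `x` items remain. -/
noncomputable def cutWeight (m x : ℕ) : ℝ :=
  ∑ p ∈ Ioc m (2 * m), ((if p + x < 4 * m then (4 * (m : ℝ) - p) / x else 1) +
    if p = x + 1 then (p : ℝ) else 0)

/-- The three ranges of `x` are the positions before every cut, among the cuts, and after all cuts.
Only in the last range does a cut `p = x + 1` contribute its extra term. -/
theorem cutWeight_early {m x : ℕ} (hx : 3 * m ≤ x) : cutWeight m x = m := by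
  have h : ∀ p ∈ Ioc m (2 * m), ((if p + x < 4 * m then (4 * (m : ℝ) - p) / x else 1) +
    if p = x + 1 then (p : ℝ) else 0) = 1 := by
    intro p hp
    rw [mem_Ioc] at hp
    rw [if_neg (by omega), if_neg (by omega), add_zero]
  rw [cutWeight, sum_congr rfl h]
  simp [two_mul]

theorem cutWeight_middle {m x : ℕ} (hx : 2 * m ≤ x) (hx' : x < 3 * m) :
    x * cutWeight m x = (3 * m * (3 * m - 1) - (x + 1) * x) / 2 + x * (x + 1 - 2 * m) := by
  have hx0 : (x : ℝ) ≠ 0 := Nat.cast_ne_zero.2 (by omega)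
  have hk : ((4 * m - 1 - x : ℕ) : ℝ) = 4 * m - 1 - x := by
    rw [Nat.sub_sub, Nat.cast_sub (by omega)]
    push_cast
    ring
  rw [cutWeight, ← sum_Ioc_consecutive _ (show m ≤ 4 * m - 1 - x by omega)
    (show 4 * m - 1 - x ≤ 2 * m by omega)]
  have h1 : ∀ p ∈ Ioc m (4 * m - 1 - x),
      ((if p + x < 4 * m then (4 * (m : ℝ) - p) / x else 1) +
        if p = x + 1 then (p : ℝ) else 0) = (4 * (m : ℝ) - p) / x := by
    intro p hp
    rw [mem_Ioc] at hp
    rw [if_pos (by omega), if_neg (by omega), add_zero]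
  have h2 : ∀ p ∈ Ioc (4 * m - 1 - x) (2 * m),
      ((if p + x < 4 * m then (4 * (m : ℝ) - p) / x else 1) +
        if p = x + 1 then (p : ℝ) else 0) = 1 := by
    intro p hp
    rw [mem_Ioc] at hp
    rw [if_neg (by omega), if_neg (by omega), add_zero]
  rw [sum_congr rfl h1, sum_congr rfl h2, ← sum_div, sum_Ioc_four_mul_sub (by omega), sum_const,
    Nat.card_Ioc, nsmul_eq_mul, mul_one,
    Nat.cast_sub (show 4 * m - 1 - x ≤ 2 * m by omega), hk]
  push_cast
  field_simp
  ring

theorem cutWeight_late {m x : ℕ} (hx : m ≤ x) (hx' : x < 2 * m) :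
    x * cutWeight m x = (5 * m ^ 2 - m) / 2 + x * (x + 1) := by
  have hx0 : (x : ℝ) ≠ 0 := Nat.cast_ne_zero.2 (by omega)
  rw [cutWeight, sum_add_distrib, sum_ite_eq', if_pos (mem_Ioc.2 ⟨by omega, by omega⟩)]
  have h1 : ∀ p ∈ Ioc m (2 * m), (if p + x < 4 * m then (4 * (m : ℝ) - p) / x else 1) =
      (4 * (m : ℝ) - p) / x := by
    intro p hp
    rw [mem_Ioc] at hp
    rw [if_pos (by omega)]
  rw [sum_congr rfl h1, ← sum_div, sum_Ioc_four_mul_sub (by omega)]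
  push_cast
  field_simp
  ring

theorem sum_range_eq_sum_Ico_reflect (m : ℕ) (f : ℕ → ℝ) :
    ∑ k ∈ range (3 * m), f k = ∑ x ∈ Ico m (4 * m), f (4 * m - 1 - x) := by
  refine sum_nbij' (fun k => 4 * m - 1 - k) (fun x => 4 * m - 1 - x) ?_ ?_ ?_ ?_ ?_
  · intro k hk
    simp only [mem_range, mem_Ico] at hk ⊢
    omega
  · intro k hk
    simp only [mem_range, mem_Ico] at hk ⊢
    omega
  · intro k hk
    simp only [mem_range] at hk
    omega
  · intro k hk
    simp only [mem_Ico] at hk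
    omega
  · intro k hk
    simp only [mem_range] at hk
    congr 1
    omega

variable {m : ℕ} {b : ℕ → ℝ} {V : ℝ}

/-- Sum over the last `m` positions `s`. For `k ≥ 3 * m`, the quotient with denominator `4 * m - k -
1` occurs once for each `s > k`, that is `4 * m - k - 1` times, so these quotients add at most one
copy of the late gains to the two from `2 * b s`. -/
theorem late_constraints_sum_le (hb : ∀ k, 0 ≤ b k) {p : ℕ} (hp : p ∈ Ioc m (2 * m))
    (h : ∀ s, p ≤ s → s < 4 * m → V ≤ (4 * (m : ℝ) - p) *
      (2 * b s + ∑ k ∈ Ico p s, b k / (4 * (m : ℝ) - k - 1)) +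
        p * b (4 * m - p) + ∑ j ∈ range p, b j) :
    m * V ≤ 3 * (4 * (m : ℝ) - p) * ∑ k ∈ Ico (3 * m) (4 * m), b k +
      m * ((4 * (m : ℝ) - p) * ∑ k ∈ Ico p (3 * m), b k / (4 * (m : ℝ) - k - 1) +
        p * b (4 * m - p) + ∑ j ∈ range p, b j) := by
  rw [mem_Ioc] at hp
  have hp4 : (0 : ℝ) ≤ 4 * (m : ℝ) - p := by
    have : (p : ℝ) ≤ (2 * m : ℕ) := Nat.cast_le.2 hp.2
    push_cast at this
    have := Nat.cast_nonneg (α := ℝ) m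
    linarith
  set S := ∑ k ∈ Ico (3 * m) (4 * m), b k with hS
  set f : ℕ → ℝ := fun k => b k / (4 * (m : ℝ) - k - 1) with hf
  have h1 : ∑ s ∈ Ico (3 * m) (4 * m), V ≤ ∑ s ∈ Ico (3 * m) (4 * m), ((4 * (m : ℝ) - p) *
      (2 * b s + (∑ k ∈ Ico p (3 * m), f k + ∑ k ∈ Ico (3 * m) s, f k)) +
        p * b (4 * m - p) + ∑ j ∈ range p, b j) := by
    refine sum_le_sum fun s hs => ?_
    rw [mem_Ico] at hs
    rw [sum_Ico_consecutive f (by omega) hs.1]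
    exact h s (by omega) hs.2
  have h2 : ∑ s ∈ Ico (3 * m) (4 * m), ∑ k ∈ Ico (3 * m) s, f k ≤ S := by
    rw [← sum_Ico_Ico_comm' (3 * m) (4 * m) fun k _ => f k]
    refine sum_le_sum fun k hk => ?_
    rw [mem_Ico] at hk
    rw [sum_const, Nat.card_Ico, nsmul_eq_mul, Nat.cast_sub (by omega), hf]
    push_cast
    rw [sub_add_eq_sub_sub]
    -- For the last position the denominator is zero, but no `s` follows it.
    rcases eq_or_ne (4 * (m : ℝ) - k - 1) 0 with h0 | h0
    · rw [h0, zero_mul]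
      exact hb k
    · exact (mul_div_cancel₀ (b k) h0).le
  have hcard : ((Ico (3 * m) (4 * m)).card : ℝ) = m := by
    rw [Nat.card_Ico]
    congr 1
    omega
  simp only [sum_add_distrib, ← mul_sum, sum_const, nsmul_eq_mul, hcard] at h1
  have h3 := mul_le_mul_of_nonneg_left h2 hp4
  rw [← hS] at h1
  linarith

/-- Substitute `x = 4 * m - 1 - k`: the denominator becomes `x`, and the separate term at position
`4 * m - p` sits at `x = p - 1`. -/
theorem early_sum_eq {p : ℕ} (hp : p ∈ Ioc m (2 * m)) :
    (4 * (m : ℝ) - p) * ∑ k ∈ Ico p (3 * m), b k / (4 * (m : ℝ) - k - 1) +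
        p * b (4 * m - p) + ∑ j ∈ range p, b j =
      ∑ x ∈ Ico m (4 * m), ((if p + x < 4 * m then (4 * (m : ℝ) - p) / x else 1) +
        if p = x + 1 then (p : ℝ) else 0) * b (4 * m - 1 - x) := by
  rw [mem_Ioc] at hp
  simp only [add_mul, sum_add_distrib]
  have h1 : ∑ x ∈ Ico m (4 * m), (if p = x + 1 then (p : ℝ) else 0) * b (4 * m - 1 - x) =
      p * b (4 * m - p) := by
    rw [sum_eq_single (p - 1)]
    · rw [if_pos (by omega)]
      congr 2
      omega
    · intro x _ hx
      rw [if_neg (by omega), zero_mul]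
    · intro hx
      exact absurd (mem_Ico.2 ⟨by omega, by omega⟩) hx
  have h2 : ∑ x ∈ Ico m (4 * m), (if p + x < 4 * m then (4 * (m : ℝ) - p) / x else 1) *
        b (4 * m - 1 - x) =
      ∑ k ∈ range (3 * m), (if p ≤ k then (4 * (m : ℝ) - p) / (4 * (m : ℝ) - k - 1) else 1) *
        b k := by
    rw [sum_range_eq_sum_Ico_reflect]
    refine sum_congr rfl fun x hx => ?_
    rw [mem_Ico] at hx
    have h3 : (4 * (m : ℝ) - (4 * m - 1 - x : ℕ) - 1) = x := by
      rw [Nat.sub_sub, Nat.cast_sub (by omega)]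
      push_cast
      ring
    rw [h3]
    congr 1
    exact if_congr (by omega) rfl rfl
  rw [h1, h2, ← sum_range_add_sum_Ico _ (show p ≤ 3 * m by omega), mul_sum]
  have h4 : ∑ k ∈ range p, (if p ≤ k then (4 * (m : ℝ) - p) / (4 * (m : ℝ) - k - 1) else 1) *
      b k = ∑ k ∈ range p, b k := by
    refine sum_congr rfl fun k hk => ?_
    rw [mem_range] at hk
    rw [if_neg (by omega), one_mul]
  have h5 : ∑ k ∈ Ico p (3 * m),
      (if p ≤ k then (4 * (m : ℝ) - p) / (4 * (m : ℝ) - k - 1) else 1) * b k =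
      ∑ k ∈ Ico p (3 * m), (4 * (m : ℝ) - p) * (b k / (4 * (m : ℝ) - k - 1)) := by
    refine sum_congr rfl fun k hk => ?_
    rw [mem_Ico] at hk
    rw [if_pos hk.1]
    ring
  rw [h4, h5]
  ring

/-- All constraints with a backup solution, summed with equal weights. -/
theorem sum_cutWeight_mul_le (hb : ∀ k, 0 ≤ b k)
    (h : ∀ p s, 0 < p → p ≤ s → s < 4 * m → V ≤ (4 * (m : ℝ) - p) *
      (2 * b s + ∑ k ∈ Ico p s, b k / (4 * (m : ℝ) - k - 1)) +
        p * b (4 * m - p) + ∑ j ∈ range p, b j) :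
    m ^ 2 * V + ∑ x ∈ Ico m (4 * m), (3 * ((5 * m ^ 2 - m) / 2) - m * cutWeight m x) *
        b (4 * m - 1 - x) ≤
      3 * ((5 * m ^ 2 - m) / 2) * ∑ k ∈ range (4 * m), b k := by
  have h1 : ∑ p ∈ Ioc m (2 * m), (m : ℝ) * V ≤ ∑ p ∈ Ioc m (2 * m),
      (3 * (4 * (m : ℝ) - p) * ∑ k ∈ Ico (3 * m) (4 * m), b k +
      m * ∑ x ∈ Ico m (4 * m), ((if p + x < 4 * m then (4 * (m : ℝ) - p) / x else 1) +
        if p = x + 1 then (p : ℝ) else 0) * b (4 * m - 1 - x)) := by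
    refine sum_le_sum fun p hp => ?_
    rw [← early_sum_eq hp]
    exact late_constraints_sum_le hb hp fun s hs hs' =>
      h p s ((Nat.zero_le m).trans_lt (mem_Ioc.1 hp).1) hs hs'
  have hm : ((2 * m - m : ℕ) : ℝ) = m := by
    congr 1
    omega
  have h3 : ∑ p ∈ Ioc m (2 * m), 3 * (4 * (m : ℝ) - p) * ∑ k ∈ Ico (3 * m) (4 * m), b k =
      3 * ((5 * (m : ℝ) ^ 2 - m) / 2) * ∑ k ∈ Ico (3 * m) (4 * m), b k := by
    rw [← sum_mul, ← mul_sum, sum_Ioc_four_mul_sub (by omega)]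
    push_cast
    ring
  have h4 : ∑ p ∈ Ioc m (2 * m), (m : ℝ) * ∑ x ∈ Ico m (4 * m),
      ((if p + x < 4 * m then (4 * (m : ℝ) - p) / x else 1) +
        if p = x + 1 then (p : ℝ) else 0) * b (4 * m - 1 - x) =
      m * ∑ x ∈ Ico m (4 * m), cutWeight m x * b (4 * m - 1 - x) := by
    rw [← mul_sum, sum_comm]
    simp only [← sum_mul, cutWeight]
  rw [sum_add_distrib, h3, h4, sum_const, Nat.card_Ioc, nsmul_eq_mul, hm] at h1
  have h2 : ∑ x ∈ Ico m (4 * m), (3 * ((5 * (m : ℝ) ^ 2 - m) / 2) - m * cutWeight m x) *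
        b (4 * m - 1 - x) = 3 * ((5 * (m : ℝ) ^ 2 - m) / 2) * ∑ k ∈ range (3 * m), b k -
      m * ∑ x ∈ Ico m (4 * m), cutWeight m x * b (4 * m - 1 - x) := by
    rw [sum_range_eq_sum_Ico_reflect, mul_sum, mul_sum, ← sum_sub_distrib]
    exact sum_congr rfl fun x _ => by ring
  rw [h2, ← sum_range_add_sum_Ico b (show 3 * m ≤ 4 * m by omega)]
  linarith

/-- This is the condition that `weighted_gain_segment` puts on its weights, for the late segment;
the left side solves its recursion from the value 0 at `x = μ`. -/
theorem late_weight_ge {μ x : ℝ} (hμ : 1 ≤ μ) (h1 : μ ≤ x) (h2 : x ≤ 2 * μ) :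
    3 * ((5 * μ ^ 2 - μ) / 2) * (x * (x - 1) - μ * (μ - 1)) -
        2 * μ * ((5 * μ ^ 2 - μ) / 2) * (x - μ) -
        2 * μ / 3 * ((x - 1) * x * (x + 1) - (μ - 1) * μ * (μ + 1)) ≤
      (3 * ((5 * μ ^ 2 - μ) / 2) * x - μ * ((5 * μ ^ 2 - μ) / 2 + x * (x + 1))) * (x - 1) := by
  -- The difference of the two sides, written so that its sign on `μ ≤ x ≤ 2 * μ` is visible.
  have h : 0 ≤ μ / 3 * ((2 * μ - x) * (x - μ) * (x + 3 * μ) +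
      (x - μ) * ((μ - 1) * (25 / 2 * μ - 7)) + (2 * μ - x) * (6 * (2 * μ - 1) * (μ - 1))) := by
    have h3 : 0 ≤ x - μ := by linarith
    have h4 : 0 ≤ 2 * μ - x := by linarith
    have h5 : 0 ≤ μ - 1 := by linarith
    have h6 : 0 ≤ 25 / 2 * μ - 7 := by linarith
    have h7 : 0 ≤ 2 * μ - 1 := by linarith
    have h8 : 0 ≤ x + 3 * μ := by linarith
    positivity
  linarith

/-- The same condition on the middle segment; the constant terms are the late solution at `x = 2 *
μ`. -/
theorem middle_weight_ge {μ x : ℝ} (hμ : 1 ≤ μ) (h1 : 2 * μ ≤ x) (h2 : x ≤ 3 * μ) :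
    77 / 6 * μ ^ 4 - 11 * μ ^ 3 + 13 / 6 * μ ^ 2 +
        (3 * ((5 * μ ^ 2 - μ) / 2) + 2 * μ ^ 2) * (x * (x - 1) - 2 * μ * (2 * μ - 1)) -
        3 * μ ^ 2 * (3 * μ - 1) * (x - 2 * μ) -
        μ / 3 * ((x - 1) * x * (x + 1) - (2 * μ - 1) * (2 * μ) * (2 * μ + 1)) ≤
      (3 * ((5 * μ ^ 2 - μ) / 2) * x - μ * ((3 * μ * (3 * μ - 1) - (x + 1) * x) / 2 +
        x * (x + 1 - 2 * μ))) * (x - 1) := by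
  have h : 0 ≤ μ / 6 * ((3 * μ - x) * (x - 2 * μ) * (x + 5 * μ)) +
      (x - 2 * μ) * (μ / 2 * (27 * μ ^ 2 - 16 * μ + 1)) +
      (3 * μ - x) * (μ / 6 * (73 * μ ^ 2 - 39 * μ + 2)) := by
    have h3 : 0 ≤ x - 2 * μ := by linarith
    have h4 : 0 ≤ 3 * μ - x := by linarith
    have h5 : 0 ≤ x + 5 * μ := by linarith
    have h6 : 0 ≤ 27 * μ ^ 2 - 16 * μ + 1 := by nlinarith
    have h7 : 0 ≤ 73 * μ ^ 2 - 39 * μ + 2 := by nlinarith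
    positivity
  linarith

/-- The factor-revealing bound for the expected gains `b` of an algorithm on `4 * m` items. -/
theorem sum_gains_ge {m : ℕ} (hm : 0 < m) {b : ℕ → ℝ} {V : ℝ} (hV : 0 ≤ V) (hb : ∀ k, 0 ≤ b k)
    (h₁ : ∀ k, k < 4 * m → V - 2 * ∑ j ∈ range k, b j ≤ (4 * (m : ℝ) - k) * b k)
    (h₂ : ∀ p s, 0 < p → p ≤ s → s < 4 * m → V ≤ (4 * (m : ℝ) - p) *
      (2 * b s + ∑ k ∈ Ico p s, b k / (4 * (m : ℝ) - k - 1)) +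
        p * b (4 * m - p) + ∑ j ∈ range p, b j) :
    49 / 96 * V ≤ ∑ k ∈ range (4 * m), b k := by
  have hsum := sum_cutWeight_mul_le hb h₂
  set μ : ℝ := (m : ℝ) with hμdef
  have hμ : 1 ≤ μ := by
    rw [hμdef]
    exact_mod_cast hm
  set c : ℕ → ℝ := fun x => 3 * ((5 * μ ^ 2 - μ) / 2) - μ * cutWeight m x with hcdef
  set β : ℕ → ℝ := fun x => b (4 * m - 1 - x) with hβdef
  set e : ℕ → ℝ := fun x => V / 2 - ∑ j ∈ range (4 * m - x), b j with hedef
  have he : ∀ x, x < 4 * m → e x = e (x + 1) - β x := by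
    intro x hx
    have h : 4 * m - x = (4 * m - 1 - x) + 1 := by omega
    have h' : 4 * m - (x + 1) = 4 * m - 1 - x := by omega
    simp only [hedef, hβdef]
    rw [h, h', sum_range_succ]
    ring
  have hβ : ∀ x, x < 4 * m → 2 * e (x + 1) ≤ ((x : ℝ) + 1) * β x := by
    intro x hx
    have h := h₁ (4 * m - 1 - x) (by omega)
    have h' : 4 * m - (x + 1) = 4 * m - 1 - x := by omega
    have h3 : 4 * μ - (4 * m - 1 - x : ℕ) = x + 1 := by
      rw [Nat.sub_sub, Nat.cast_sub (by omega)]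
      push_cast
      ring
    rw [h3] at h
    simp only [hedef, hβdef]
    rw [h']
    linarith
  have hclate : ∀ x, m ≤ x → x < 2 * m → (x : ℝ) * c x =
      3 * ((5 * μ ^ 2 - μ) / 2) * x - μ * ((5 * μ ^ 2 - μ) / 2 + x * (x + 1)) := by
    intro x hx hx'
    have h := cutWeight_late hx hx'
    rw [← hμdef] at h
    rw [← h]
    ring
  have hcmid : ∀ x, 2 * m ≤ x → x < 3 * m → (x : ℝ) * c x =
      3 * ((5 * μ ^ 2 - μ) / 2) * x - μ * ((3 * μ * (3 * μ - 1) - (x + 1) * x) / 2 +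
        x * (x + 1 - 2 * μ)) := by
    intro x hx hx'
    have h := cutWeight_middle hx hx'
    rw [← hμdef] at h
    rw [← h]
    ring
  have hcearly : ∀ x, 3 * m ≤ x → c x = 3 * ((5 * μ ^ 2 - μ) / 2) - μ * μ := by
    intro x hx
    simp only [hcdef, cutWeight_early hx]
    rfl
  -- Closed forms of the recursion on the three segments. They start from 0 at `x = m`, since the
  -- last `m` positions carry no slack, and each later one begins with the value reached by its
  -- predecessor, at `2 * m` and `3 * m`.
  set Θlate : ℕ → ℝ := fun x => 3 * ((5 * μ ^ 2 - μ) / 2) * (x * (x - 1) - μ * (μ - 1)) -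
        2 * μ * ((5 * μ ^ 2 - μ) / 2) * (x - μ) -
        2 * μ / 3 * ((x - 1) * x * (x + 1) - (μ - 1) * μ * (μ + 1)) with hΘlate
  set Θmid : ℕ → ℝ := fun x => 77 / 6 * μ ^ 4 - 11 * μ ^ 3 + 13 / 6 * μ ^ 2 +
        (3 * ((5 * μ ^ 2 - μ) / 2) + 2 * μ ^ 2) * (x * (x - 1) - 2 * μ * (2 * μ - 1)) -
        3 * μ ^ 2 * (3 * μ - 1) * (x - 2 * μ) -
        μ / 3 * ((x - 1) * x * (x + 1) - (2 * μ - 1) * (2 * μ) * (2 * μ + 1)) with hΘmid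
  set Θearly : ℕ → ℝ := fun x => 45 * μ ^ 4 - 25 * μ ^ 3 + 4 * μ ^ 2 +
        (3 * ((5 * μ ^ 2 - μ) / 2) - μ * μ) * (x * (x - 1) - 3 * μ * (3 * μ - 1)) with hΘearly
  have hlate : Θlate (2 * m) / (((2 * m : ℕ) : ℝ) * ((2 * m : ℕ) - 1)) * e (2 * m) ≤
      0 + ∑ x ∈ Ico m (2 * m), c x * β x := by
    refine weighted_gain_segment hm (by omega) ?_ (fun x _ h => he x (by omega))
      (fun x _ h => hβ x (by omega)) ?_ ?_ ?_
    · intro h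
      have hμ1 : μ = 1 := by rw [hμdef, h]; simp
      refine ⟨by simp [hΘlate, hμ1], ?_⟩
      have h3 := hclate 1 h.le (by omega)
      rw [hμ1] at h3
      norm_num at h3
      rw [h3]
      norm_num
    · intro x hx hx'
      rw [hclate x hx hx']
      simp only [hΘlate]
      push_cast
      ring
    · intro x hx hx'
      rw [hclate x hx hx']
      exact late_weight_ge hμ (by rw [hμdef]; exact_mod_cast hx) (by rw [hμdef]; exact_mod_cast hx'.le)
    · simp [hΘlate, hμdef]
  have hmid : Θmid (3 * m) / (((3 * m : ℕ) : ℝ) * ((3 * m : ℕ) - 1)) * e (3 * m) ≤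
      (0 + ∑ x ∈ Ico m (2 * m), c x * β x) + ∑ x ∈ Ico (2 * m) (3 * m), c x * β x := by
    refine weighted_gain_segment (by omega) (by omega) (fun h => by omega)
      (fun x _ h => he x (by omega)) (fun x _ h => hβ x (by omega)) ?_ ?_ ?_
    · intro x hx hx'
      rw [hcmid x hx hx']
      simp only [hΘmid]
      push_cast
      ring
    · intro x hx hx'
      rw [hcmid x hx hx']
      exact middle_weight_ge hμ (by rw [hμdef]; exact_mod_cast hx) (by rw [hμdef]; exact_mod_cast hx'.le)
    · have h : Θmid (2 * m) = Θlate (2 * m) := by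
        simp only [hΘmid, hΘlate]
        push_cast
        ring
      rw [h]
      exact hlate
  have hearly : Θearly (4 * m) / (((4 * m : ℕ) : ℝ) * ((4 * m : ℕ) - 1)) * e (4 * m) ≤
      ((0 + ∑ x ∈ Ico m (2 * m), c x * β x) + ∑ x ∈ Ico (2 * m) (3 * m), c x * β x) +
        ∑ x ∈ Ico (3 * m) (4 * m), c x * β x := by
    refine weighted_gain_segment (by omega) (by omega) (fun h => by omega)
      (fun x _ h => he x (by omega)) (fun x _ h => hβ x (by omega)) ?_ ?_ ?_
    · intro x hx hx'
      rw [hcearly x hx]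
      simp only [hΘearly]
      push_cast
      ring
    · intro x hx hx'
      rw [hcearly x hx]
      simp only [hΘearly]
      -- The weights are constant here, so the gap does not depend on `x`: it is half of this
      -- product.
      have h : 0 ≤ μ ^ 2 * (27 * μ ^ 2 - 16 * μ + 1) :=
        mul_nonneg (sq_nonneg μ) (by nlinarith)
      linarith
    · have h : Θearly (3 * m) = Θmid (3 * m) := by
        simp only [hΘmid, hΘearly]
        push_cast
        ring
      rw [h]
      exact hmid
  rw [zero_add, sum_Ico_consecutive _ (by omega) (by omega),
    sum_Ico_consecutive _ (by omega) (by omega)] at hearly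
  have he4 : e (4 * m) = V / 2 := by simp [hedef]
  have hΘ4 : Θearly (4 * m) / (((4 * m : ℕ) : ℝ) * ((4 * m : ℕ) - 1)) =
      (181 * μ ^ 3 - 84 * μ ^ 2 + 11 * μ) / (8 * (4 * μ - 1)) := by
    have h1 : 4 * μ - 1 ≠ 0 := by
      have : 0 < 4 * μ - 1 := by linarith
      exact this.ne'
    have h2 : μ ≠ 0 := by
      have : 0 < μ := by linarith
      exact this.ne'
    simp only [hΘearly]
    push_cast
    rw [← hμdef, div_eq_div_iff (by positivity) (by positivity)]
    ring
  -- The linear term is chosen so that `h8` is an identity, giving 49/96 for every `m` without a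
  -- lower-order error.
  have hΘ5 : 181 / 32 * μ ^ 2 - 49 / 32 * μ ≤ Θearly (4 * m) /
      (((4 * m : ℕ) : ℝ) * ((4 * m : ℕ) - 1)) := by
    rw [hΘ4, le_div_iff₀ (by linarith)]
    nlinarith
  rw [he4] at hearly
  have h6 := mul_le_mul_of_nonneg_right hΘ5 (div_nonneg hV zero_le_two)
  have hW : 0 < 3 * ((5 * μ ^ 2 - μ) / 2) := by nlinarith
  refine le_of_mul_le_mul_left ?_ hW
  refine le_trans ?_ hsum
  have h7 : (181 / 32 * μ ^ 2 - 49 / 32 * μ) * (V / 2) ≤ ∑ x ∈ Ico m (4 * m), c x * β x :=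
    h6.trans hearly
  have h8 : 3 * ((5 * μ ^ 2 - μ) / 2) * (49 / 96 * V) =
      μ ^ 2 * V + (181 / 32 * μ ^ 2 - 49 / 32 * μ) * (V / 2) := by ring
  rw [h8]
  exact add_le_add_right h7 _

end FactorRevealing

/-! ### Padding with worthless items. -/

section Padding

open scoped BigOperators

set_option linter.unusedSectionVars false

variable {N M : Type*} [Fintype N] [DecidableEq N] [Fintype M] [DecidableEq M]

theorem OnlineRule.IsGreedy.welfare_le_expect {v : M → Finset N → ℝ} {r : OnlineRule N M} {m : ℕ}
    [Nonempty (Fin (4 * m) ≃ N)] (hm : 0 < m) (hr : r.IsGreedy v) (hval : ∀ l, IsValuation (v l))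
    (O : Allocation N M) :
    49 / 96 * welfare v O ≤
      𝔼 τ : Fin (4 * m) ≃ N, welfare v (r.alloc (List.ofFn τ).reverse) := by
  have hv : ∀ l, Monotone (v l) := fun l => (hval l).monotone
  have hs : ∀ l, IsSubmodular (v l) := fun l => (hval l).submodular
  have h0 : 0 ≤ jointValue v ∅ := sum_nonneg fun l _ => (hval l).nonneg _
  have hV : 0 ≤ welfare v O - jointValue v ∅ := by
    rw [← jointValue_graph]
    exact sub_nonneg.2 (jointValue_monotone hv (empty_subset _))
  have h1 := sum_gains_ge hm hV (fun k => r.meanGain_nonneg (n := 4 * m) hv k)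
    (fun k hk => by
      have h := hr.mul_meanGain_ge hv hs O hk
      push_cast at h
      exact h)
    (fun p s hp hps hs' => by
      have h := hr.welfare_le_late hv hs O hp hps hs'
      push_cast at h
      exact h)
  have h2 := OnlineRule.expect_value_arrivals (v := v) (r := r) (le_refl (4 * m))
  have h3 : ∀ τ : Fin (4 * m) ≃ N, r.value v (arrivals τ (4 * m)) =
      welfare v (r.alloc (List.ofFn τ).reverse) := fun τ => by
    rw [OnlineRule.value, jointValue_graph, arrivals_eq_reverse_ofFn]
  rw [expect_congr rfl fun τ _ => h3 τ] at h2
  rw [h2]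
  linarith

/-- The valuations that ignore the `k` additional dummy items. -/
def padValuation (v : M → Finset N → ℝ) (k : ℕ) (l : M) (S : Finset (N ⊕ Fin k)) : ℝ :=
  v l {e : N | Sum.inl e ∈ S}

/-- The proper items of a history with dummy items. -/
def properItems {k : ℕ} (h : List (N ⊕ Fin k)) : List N := h.filterMap Sum.getLeft?

/-- The rule that gives all dummy items to the agent `l₀`, and proper items as `r` does. -/
def OnlineRule.pad (r : OnlineRule N M) (k : ℕ) (l₀ : M) : OnlineRule (N ⊕ Fin k) M :=
  fun h e => Sum.elim (r (properItems h)) (fun _ => l₀) e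

theorem padValuation_isValuation {v : M → Finset N → ℝ} (hval : ∀ l, IsValuation (v l)) (k : ℕ)
    (l : M) : IsValuation (padValuation v k l) where
  nonneg A := (hval l).nonneg _
  monotone A B hAB := (hval l).monotone fun e => by
    simp only [mem_filter, mem_univ, true_and]
    exact fun h => hAB h
  submodular A B := by
    have h := (hval l).submodular {e : N | Sum.inl e ∈ A} {e : N | Sum.inl e ∈ B}
    rw [← filter_or, ← filter_and] at h
    simpa only [padValuation, mem_union, mem_inter] using h

theorem OnlineRule.alloc_pad_inl (r : OnlineRule N M) (k : ℕ) (l₀ : M) (h : List (N ⊕ Fin k))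
    (e : N) : (r.pad k l₀).alloc h (Sum.inl e) = r.alloc (properItems h) e := by
  induction h with
  | nil => rfl
  | cons x h ih =>
    rcases x with x | x
    · have h1 : properItems (Sum.inl x :: h) = x :: properItems h := by simp [properItems]
      rw [h1]
      simp only [OnlineRule.alloc]
      by_cases hx : e = x
      · subst hx
        simp [OnlineRule.pad]
      · rw [Function.update_of_ne hx, Function.update_of_ne (by simpa using hx), ih]
    · have h1 : properItems (Sum.inr x :: h) = properItems h :=
        List.filterMap_cons_none rfl
      rw [h1, ← ih]
      simp only [OnlineRule.alloc]
      rw [Function.update_of_ne (by simp)]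

theorem OnlineRule.bundle_alloc_pad (r : OnlineRule N M) (k : ℕ) (l₀ : M)
    (h : List (N ⊕ Fin k)) (l : M) :
    ({e : N | Sum.inl e ∈ ((r.pad k l₀).alloc h).bundle l} : Finset N) =
      (r.alloc (properItems h)).bundle l := by
  ext e
  simp [Allocation.bundle, OnlineRule.alloc_pad_inl]

theorem nodup_properItems {k : ℕ} {h : List (N ⊕ Fin k)} (hh : h.Nodup) :
    (properItems h).Nodup := by
  refine hh.filterMap ?_
  rintro (a | a) (b | b) c ha hb <;> simp_all

/-- A dummy has zero marginal gain for every agent, so any recipient is a greedy choice; a proper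
item meets the same proper bundles as without dummies. -/
theorem OnlineRule.IsGreedy.pad {v : M → Finset N → ℝ} {r : OnlineRule N M} (hr : r.IsGreedy v)
    (k : ℕ) (l₀ : M) : (r.pad k l₀).IsGreedy (padValuation v k) := by
  intro h e he l
  have key : ∀ l, ∀ x : N, marginalGain (padValuation v k l) (((r.pad k l₀).alloc h).bundle l)
      (Sum.inl x) = marginalGain (v l) ((r.alloc (properItems h)).bundle l) x := by
    intro l x
    simp only [marginalGain, padValuation, ← OnlineRule.bundle_alloc_pad r k l₀]
    congr 2
    ext y
    simp
  have key' : ∀ l, ∀ x : Fin k, marginalGain (padValuation v k l)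
      (((r.pad k l₀).alloc h).bundle l) (Sum.inr x) = 0 := by
    intro l x
    simp [marginalGain, padValuation]
  rcases e with e | e
  · rw [key, key]
    refine hr _ e ?_ l
    have h1 := nodup_properItems he
    simpa [properItems] using h1
  · rw [key', key']

theorem OnlineRule.welfare_alloc_pad (v : M → Finset N → ℝ) (r : OnlineRule N M) (k : ℕ) (l₀ : M)
    (h : List (N ⊕ Fin k)) :
    welfare (padValuation v k) ((r.pad k l₀).alloc h) = welfare v (r.alloc (properItems h)) := by
  unfold welfare padValuation
  exact sum_congr rfl fun l _ => congrArg (v l) (OnlineRule.bundle_alloc_pad r k l₀ h l)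

theorem welfare_pad (v : M → Finset N → ℝ) (k : ℕ) (O : Allocation N M) :
    welfare (padValuation v k) (Sum.elim O fun _ => none : Allocation (N ⊕ Fin k) M) =
      welfare v O := by
  unfold welfare padValuation
  refine sum_congr rfl fun l _ => congrArg (v l) ?_
  ext e
  simp [Allocation.bundle]

theorem expect_map_perm {L : List N} (hL : L.Nodup) (hmem : ∀ e, e ∈ L) (f : List N → ℝ) :
    𝔼 π : Equiv.Perm N, f (L.map π) =
      𝔼 σ : Fin (Fintype.card N) ≃ N, f (List.ofFn σ).reverse := by
  have hL' : L.reverse.Nodup := List.nodup_reverse.2 hL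
  have hlen : Fintype.card N = L.reverse.length := by
    rw [← List.toFinset_card_of_nodup hL', ← card_univ]
    congr 1
    ext e
    simp [hmem e]
  let σ₀ : Fin (Fintype.card N) ≃ N := (finCongr hlen).trans
    (hL'.getEquivOfForallMemList _ fun e => List.mem_reverse.2 (hmem e))
  have hσ₀ : List.ofFn σ₀ = L.reverse :=
    List.ext_getElem (by simp [hlen]) fun i h1 h2 => by simp [σ₀]
  refine Fintype.expect_equiv
    ⟨fun π => σ₀.trans π, fun σ => σ₀.symm.trans σ, fun π => by ext; simp,
      fun σ => by ext; simp⟩ _ _ fun π => ?_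
  have h : List.ofFn (σ₀.trans π) = (List.ofFn σ₀).map π := by
    rw [List.map_ofFn]
    rfl
  simp only [Equiv.coe_fn_mk]
  rw [h, hσ₀, ← List.map_reverse, List.reverse_reverse]

/-- The order of the proper items is uniformly random. -/
theorem expect_properItems {k n : ℕ} [Nonempty (Fin n ≃ N ⊕ Fin k)] (f : List N → ℝ) :
    𝔼 τ : Fin n ≃ N ⊕ Fin k, f (properItems (List.ofFn τ).reverse) =
      𝔼 σ : Fin (Fintype.card N) ≃ N, f (List.ofFn σ).reverse := by
  -- Relabelling the proper items permutes the padded orders, while for a fixed padded order a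
  -- random relabelling already makes the proper order uniform. Exchanging the two averages combines
  -- these facts.
  have h1 : ∀ π : Equiv.Perm N,
      𝔼 τ : Fin n ≃ N ⊕ Fin k, f ((properItems (List.ofFn τ).reverse).map π) =
        𝔼 τ : Fin n ≃ N ⊕ Fin k, f (properItems (List.ofFn τ).reverse) := by
    intro π
    set π' : Equiv.Perm (N ⊕ Fin k) := Equiv.sumCongr π (Equiv.refl _)
    refine Fintype.expect_equiv
      ⟨fun τ => τ.trans π', fun τ => τ.trans π'.symm, fun τ => by ext; simp,
        fun τ => by ext; simp⟩ _ _ fun τ => ?_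
    have h : List.ofFn (τ.trans π') = (List.ofFn τ).map π' := by
      rw [List.map_ofFn]
      rfl
    simp only [Equiv.coe_fn_mk]
    rw [h, ← List.map_reverse, properItems, properItems, List.map_filterMap, List.filterMap_map]
    congr 2
    funext x
    rcases x with x | x <;> simp [π']
  have h2 : ∀ τ : Fin n ≃ N ⊕ Fin k,
      𝔼 π : Equiv.Perm N, f ((properItems (List.ofFn τ).reverse).map π) =
        𝔼 σ : Fin (Fintype.card N) ≃ N, f (List.ofFn σ).reverse := by
    intro τ
    refine expect_map_perm (nodup_properItems ?_) (fun e => ?_) f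
    · exact List.nodup_reverse.2 (List.nodup_ofFn.2 τ.injective)
    · simp only [properItems, List.mem_filterMap, List.mem_reverse, List.mem_ofFn]
      exact ⟨Sum.inl e, τ.surjective _, rfl⟩
  have h3 := expect_comm (univ : Finset (Equiv.Perm N)) (univ : Finset (Fin n ≃ N ⊕ Fin k))
    fun π τ => f ((properItems (List.ofFn τ).reverse).map π)
  rwa [expect_congr rfl fun π _ => h1 π, expect_congr rfl fun τ _ => h2 τ, Fintype.expect_const,
    Fintype.expect_const] at h3

theorem OnlineRule.expectedWelfare_eq_expect (v : M → Finset N → ℝ) (r : OnlineRule N M) :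
    r.expectedWelfare v =
      𝔼 σ : Fin (Fintype.card N) ≃ N, welfare v (r.alloc (List.ofFn σ).reverse) := by
  rw [Fintype.expect_eq_sum_div_card, Fintype.card_equiv (Fintype.equivFin N).symm,
    Fintype.card_fin]
  rfl

/-- In random order, greedy obtains at least `49 / 96` of the welfare of every allocation. -/
theorem OnlineRule.IsGreedy.welfare_le_expectedWelfare {v : M → Finset N → ℝ}
    {r : OnlineRule N M} (hr : r.IsGreedy v) (hval : ∀ l, IsValuation (v l))
    (O : Allocation N M) : 49 / 96 * welfare v O ≤ r.expectedWelfare v := by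
  rw [OnlineRule.expectedWelfare_eq_expect]
  rcases isEmpty_or_nonempty N with hN | ⟨⟨e₀⟩⟩
  · have h : ∀ σ : Fin (Fintype.card N) ≃ N,
        welfare v (r.alloc (List.ofFn σ).reverse) = welfare v O :=
      fun σ => congrArg (welfare v) (Subsingleton.elim _ _)
    have h0 : 0 ≤ welfare v O := sum_nonneg fun l _ => (hval l).nonneg _
    rw [expect_congr rfl fun σ _ => h σ,
      expect_const ⟨(Fintype.equivFin N).symm, mem_univ _⟩]
    linarith
  · have hm : 0 < Fintype.card N := Fintype.card_pos_iff.2 ⟨e₀⟩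
    have hcard : Fintype.card (N ⊕ Fin (3 * Fintype.card N)) = 4 * Fintype.card N := by
      rw [Fintype.card_sum, Fintype.card_fin]
      ring
    have : Nonempty (Fin (4 * Fintype.card N) ≃ N ⊕ Fin (3 * Fintype.card N)) :=
      ⟨(Fintype.equivFinOfCardEq hcard).symm⟩
    -- The `3 * card N` dummies make the item count `4 * m` with `m = card N`; `r [] e₀` merely
    -- provides some agent.
    have h := (hr.pad (3 * Fintype.card N) (r [] e₀)).welfare_le_expect hm
      (padValuation_isValuation hval _) (Sum.elim O fun _ => none)
    rw [welfare_pad] at h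
    simp only [OnlineRule.welfare_alloc_pad] at h
    rwa [expect_properItems fun L => welfare v (r.alloc L)] at h

end Padding

theorem theorem2 {N M : Type*} [Fintype N] [DecidableEq N] [Fintype M] [DecidableEq M]
    (v : M → Finset N → ℝ)
    (hval : ∀ l : M, IsValuation (v l))
    (hsos : ∀ l : M, IsSecondOrderSupermodular (v l))
    (r : OnlineRule N M) (hgreedy : r.IsGreedy v) :
    (0.5104 : ℝ) * optWelfare v ≤ r.expectedWelfare v := by
  obtain ⟨O, hO⟩ := exists_eq_ciSup_of_finite (f := fun A : Allocation N M => welfare v A)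
  have h0 : 0 ≤ welfare v O := sum_nonneg fun l _ => (hval l).nonneg _
  have h := hgreedy.welfare_le_expectedWelfare hval O
  rw [optWelfare, ← hO]
  -- Here 49/96 = 0.51041… exceeds 0.5104.
  linarith
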